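/- Let $T\ge 1$ and let $(a_n),(b_n)$ be $T$-periodic real sequences with all $a_n>0$ (so $a_0=a_T$). Let $J_T$ be the Jacobi matrix acting on sequences $(u_n)_{n\ge1}$ by $(J_Tu)_1=b_1u_1+a_1u_2$ and $(J_Tu)_n=a_{n-1}u_{n-1}+b_nu_n+a_nu_{n+1}$ for $n\ge2$. For $\lambda\in\mathbb{R}$ put $$B_i(\lambda)=\begin{pmatrix}0&1\\-\frac{a_{i-1}}{a_i}&\frac{\lambda-b_i}{a_i}\end{pmatrix},\qquad M(\lambda)=B_T(\lambda)\cdots B_1(\lambda),\qquad \sigma_{ell}(J_T)=\{\lambda\in\mathbb{R}:|\mathrm{Tr}\,M(\lambda)|<2\},$$ and for $\lambda\in\sigma_{ell}(J_T)$ let the quasi-momentum $\theta(\lambda)\in(0,\pi)$ be defined by the condition that the eigenvalues of $M(\lambda)$ are $e^{\pm i\theta(\lambda)}$. Let $(\lambda_i)_{i\ge1}$ be a sequence in $\sigma_{ell}(J_T)$ such that, for every $n\ge2$, the numbers $\pi,\theta(\lambda_2),\dots,\theta(\lambda_n)$ are linearly independent over $\mathbb{Q}$, while $\theta(\lambda_1)=\frac{p\pi}{q}\ne\frac{\pi}{2}$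 with $p,q$ positive integers and $\gcd(p,q)=1$. Then for every positive sequence $(K(n))_{n\ge1}$ with $K(n)\to\infty$ (however slowly) there is a real sequence $(q_n)_{n\ge1}$ with $$|q_n|\le\frac{K(n)}{n}\ \text{ for all } n\ge1,\qquad q_n\to0,\qquad q_n=0\ \text{ unless } n\equiv1 \bmod T,$$ and, for every $i\ge1$, a non-zero vector $(u_{n,i})_{n\ge1}\in\ell^2(\mathbb{N};\mathbb{R})$ such that $$(J_T+Q)(u_{n,i})_{n\ge1}=\lambda_i\,(u_{n,i})_{n\ge1},$$ where $Q$ is the infinite diagonal matrix with diagonal entries $(q_n)_{n\ge1}$. The same potential $(q_n)$ serves all $i$. -/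

import Mathlib

open Real Filter Topology

noncomputable section

/-- The infinite Jacobi matrix, with rows and columns `1, 2, 3, …`, whose diagonal is
`b 1, b 2, …` and whose two off-diagonals are `a 1, a 2, …`. -/
def jacobiMatrix (a b : ℕ → ℝ) : Matrix ℕ+ ℕ+ ℝ := fun m n =>
  if m = n then b m else if n = m + 1 then a m else if m = n + 1 then a n else 0

/-- `u` is a non-zero element of the real sequence space `ℓ²` with `A u = x u`, the product of the
infinite matrix `A` and the column `u` being computed row by row. -/
def IsEigenvector (A : Matrix ℕ+ ℕ+ ℝ) (x : ℝ) (u : lp (fun _ : ℕ+ => ℝ) 2) : Prop :=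
  u ≠ 0 ∧ ∀ n, HasSum (fun m => A n m * u m) (x * u n)

/-- The transfer matrix `B_i(x)`, for `i ≥ 1`. For `T`-periodic `a` we have `a 0 = a T`. -/
def transferMatrix (a b : ℕ → ℝ) (x : ℝ) (i : ℕ) : Matrix (Fin 2) (Fin 2) ℝ :=
  !![0, 1; -(a (i - 1) / a i), (x - b i) / a i]

/-- The product `B_k(x) ⋯ B_2(x) B_1(x)`. For coefficients of period `T` and `k = T` this is the
monodromy matrix `M(x)`. -/
def monodromyMatrix (a b : ℕ → ℝ) (x : ℝ) : ℕ → Matrix (Fin 2) (Fin 2) ℝ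
  | 0 => 1
  | k + 1 => transferMatrix a b x (k + 1) * monodromyMatrix a b x k

/-- The generalised interior of the essential spectrum: the set of elliptic points. -/
def ellipticPoints (a b : ℕ → ℝ) (T : ℕ) : Set ℝ :=
  {x | |(monodromyMatrix a b x T).trace| < 2}

/-- `θ ∈ (0, π)` and the eigenvalues of the monodromy matrix at `x` are `exp (± i θ)`. -/
def IsQuasiMomentum (a b : ℕ → ℝ) (T : ℕ) (x θ : ℝ) : Prop :=
  θ ∈ Set.Ioo 0 π ∧
    spectrum ℂ ((monodromyMatrix a b x T).map (algebraMap ℝ ℂ)) =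
      {Complex.exp (Complex.I * θ), Complex.exp (-(Complex.I * θ))}

open Classical in
/-- The quasi-momentum `θ(x)`. It is used at elliptic points only, where it exists and is unique by
`existsUnique_isQuasiMomentum`; elsewhere it has the dummy value `0`. -/
def quasiMomentum (a b : ℕ → ℝ) (T : ℕ) (x : ℝ) : ℝ :=
  if h : ∃ θ, IsQuasiMomentum a b T x θ then h.choose else 0

theorem det_monodromyMatrix (a b : ℕ → ℝ) (x : ℝ) (ha : ∀ n, 0 < a n) (k : ℕ) :
    (monodromyMatrix a b x k).det = a 0 / a k := by
  induction k with
  | zero => simp [monodromyMatrix, (ha 0).ne']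
  | succ k ih =>
    have h1 := (ha k).ne'
    have h2 := (ha (k + 1)).ne'
    rw [monodromyMatrix, Matrix.det_mul, ih, transferMatrix, Matrix.det_fin_two_of]
    simp only [Nat.add_sub_cancel]
    field_simp
    ring

theorem mem_spectrum_monodromyMatrix (a b : ℕ → ℝ) (T : ℕ) (x : ℝ) (ha : ∀ n, 0 < a n)
    (haT : Function.Periodic a T) (z : ℂ) :
    z ∈ spectrum ℂ ((monodromyMatrix a b x T).map (algebraMap ℝ ℂ)) ↔
      z ^ 2 - ((monodromyMatrix a b x T).trace : ℂ) * z + 1 = 0 := by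
  have hdet : (monodromyMatrix a b x T).det = 1 := by
    rw [det_monodromyMatrix a b x ha, haT.eq, div_self (ha 0).ne']
  generalize monodromyMatrix a b x T = M at hdet ⊢
  rw [spectrum.mem_iff, Matrix.isUnit_iff_isUnit_det, isUnit_iff_ne_zero, not_not,
    Matrix.det_fin_two]
  rw [Matrix.det_fin_two] at hdet
  have hd : (M 0 0 : ℂ) * M 1 1 - M 0 1 * M 1 0 = 1 := by exact_mod_cast hdet
  simp only [Matrix.sub_apply, Matrix.algebraMap_matrix_apply, Matrix.map_apply,
    Matrix.trace_fin_two, Complex.coe_algebraMap]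
  simp only [Fin.isValue, ↓reduceIte, Algebra.algebraMap_self, RingHom.id_apply, zero_ne_one,
    one_ne_zero, Complex.ofReal_add]
  constructor
  · intro h
    linear_combination h - hd
  · intro h
    linear_combination h + hd

/-- The quasi-momentum is well defined at every elliptic point. -/
theorem existsUnique_isQuasiMomentum (a b : ℕ → ℝ) (T : ℕ) (x : ℝ) (ha : ∀ n, 0 < a n)
    (haT : Function.Periodic a T) (hx : x ∈ ellipticPoints a b T) :
    ∃! θ, IsQuasiMomentum a b T x θ := by
  have hx' : |(monodromyMatrix a b x T).trace| < 2 := hx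
  have hs := mem_spectrum_monodromyMatrix a b T x ha haT
  set t := (monodromyMatrix a b x T).trace with ht
  have hsum : ∀ θ : ℝ, Complex.exp (Complex.I * θ) + Complex.exp (-(Complex.I * θ))
      = ((2 * Real.cos θ : ℝ) : ℂ) := by
    intro θ
    push_cast
    rw [Complex.cos]
    ring_nf
  have hprod : ∀ θ : ℝ, Complex.exp (Complex.I * θ) * Complex.exp (-(Complex.I * θ)) = 1 := by
    intro θ
    rw [← Complex.exp_add]
    simp
  have key : ∀ θ ∈ Set.Ioo 0 π, (IsQuasiMomentum a b T x θ ↔ 2 * Real.cos θ = t) := by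
    intro θ hθ
    constructor
    · rintro ⟨-, h⟩
      have h1 : Complex.exp (Complex.I * θ) ^ 2 - (t : ℂ) * Complex.exp (Complex.I * θ) + 1 = 0 :=
        (hs _).1 (by rw [h]; simp)
      have h2 : Complex.exp (Complex.I * θ) * (((2 * Real.cos θ : ℝ) : ℂ) - t) = 0 := by
        rw [← hsum]
        linear_combination h1 + hprod θ
      rcases mul_eq_zero.1 h2 with h3 | h3
      · exact absurd h3 (Complex.exp_ne_zero _)
      · exact_mod_cast sub_eq_zero.1 h3
    · intro h
      refine ⟨hθ, ?_⟩
      ext z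
      rw [hs, ← h, ← hsum, Set.mem_insert_iff, Set.mem_singleton_iff, ← sub_eq_zero (a := z),
        ← sub_eq_zero (a := z) (b := Complex.exp (-(Complex.I * θ))), ← mul_eq_zero]
      constructor
      · intro h'
        linear_combination h' + hprod θ
      · intro h'
        linear_combination h' - hprod θ
  obtain ⟨h1, h2⟩ := abs_lt.1 hx'
  have hmem : Real.arccos (t / 2) ∈ Set.Ioo 0 π := by
    refine ⟨Real.arccos_pos.2 (by linarith), ?_⟩
    refine lt_of_le_of_ne (Real.arccos_le_pi _) fun h => ?_
    rw [Real.arccos_eq_pi] at h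
    linarith
  refine ⟨Real.arccos (t / 2), (key _ hmem).2 ?_, ?_⟩
  · rw [Real.cos_arccos (by linarith) (by linarith)]
    ring
  · intro θ hθ
    have := (key θ hθ.1).1 hθ
    rw [← this, mul_div_cancel_left₀ _ two_ne_zero, Real.arccos_cos hθ.1.1.le hθ.1.2.le]

end

/-! Place the potential only at the sites kT+1, with value a₀c_k. Over one period the vector
(u_{kT}, u_{kT+1}) then undergoes a shear of size c_k followed by M(λ). At the elliptic point λ_i
there is a complex coordinate z = u_{kT} + l_i u_{kT+1} in which M(λ_i) is multiplication by
e^{iθ_i} and the shear is z ↦ z + c_k α_i Im z with α_i = 1 / Im l_i. All modes z_i are thus driven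
by the same real sequence c_k, which has to make every |z_i|² summable.

A shear by t multiplies |z|² by at most exp(t sin 2φ + t²), where φ = arg z. The feedback is c_k =
-(k+1)⁻¹ ∑_j C_j sin 2φ_j with C_j α_j = 4. In mode i the term j = i contributes -4 sin² 2φ_i /
(k+1), on average -2/(k+1), which gives |z_i|² = O(k⁻²). What remains oscillates with frequencies
2(θ_i ± θ_j), and the arithmetic hypotheses exclude θ_i + θ_j = π, also for i = j, and θ_i = θ_j for
i ≠ j. Summation by parts (`norm_sum_div_le`) therefore bounds it. The shears perturb the phases by
O(|c_k|) per step; an a priori bound |c_k| ≤ μ_k with μ square summable makes this error summable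
against 1/(k+1).

To handle infinitely many modes, the term j of the feedback is switched on only at a late time s_j,
when it uses a fraction 2^{-(j+1)} of the allowed amplitude and disturbs each mode i < j by at most
2^{-j}. `exists_shears_summable_normSq` carries out this construction, and `summable_sq_of_shears`
transfers the decay to the Jacobi recurrence. -/

/-! ### Shears in the complex plane: effect on modulus and phase -/

/-- The squared unit phase `exp (2 i arg z)` of a non-zero complex number. -/
noncomputable def sqPhase (z : ℂ) : ℂ := z / (starRingEnd ℂ) z

/-- The horizontal shear `x + i y ↦ (x + t y) + i y`. -/
noncomputable def shear (t : ℝ) (z : ℂ) : ℂ := z + ((t * z.im : ℝ) : ℂ)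

theorem shear_ne_zero (t : ℝ) {z : ℂ} (hz : z ≠ 0) : shear t z ≠ 0 := by
  intro h
  have him : z.im = 0 := by simpa [shear] using congrArg Complex.im h
  exact hz (by simpa [shear, him] using h)

theorem norm_sqPhase {z : ℂ} (hz : z ≠ 0) : ‖sqPhase z‖ = 1 := by
  rw [sqPhase, norm_div, Complex.norm_conj, div_self (norm_ne_zero_iff.2 hz)]

theorem sqPhase_mul (x z : ℂ) (hx : ‖x‖ = 1) : sqPhase (x * z) = x ^ 2 * sqPhase z := by
  have hx0 : x ≠ 0 := norm_ne_zero_iff.1 (by rw [hx]; exact one_ne_zero)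
  have h : (starRingEnd ℂ) x = x⁻¹ := (Complex.inv_eq_conj hx).symm
  rw [sqPhase, sqPhase, map_mul, h, mul_div_mul_comm, div_inv_eq_mul, sq]

theorem im_sqPhase (z : ℂ) : (sqPhase z).im = 2 * z.re * z.im / Complex.normSq z := by
  rw [sqPhase, Complex.div_im, Complex.normSq_conj, Complex.conj_re, Complex.conj_im]
  ring

/-- Expanding the square gives the first-order term 2t Re z Im z, which is t |z|² sin(2 arg z); then
1 + s ≤ exp s. -/
theorem normSq_shear_le (t : ℝ) {z : ℂ} (hz : z ≠ 0) :
    Complex.normSq (shear t z) ≤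
      Complex.normSq z * Real.exp (t * (sqPhase z).im + t ^ 2) := by
  have hN : 0 < Complex.normSq z := Complex.normSq_pos.2 hz
  have h1 : Complex.normSq (shear t z) ≤
      Complex.normSq z * (t * (sqPhase z).im + t ^ 2 + 1) := by
    have h2 : Complex.normSq z * (sqPhase z).im = 2 * z.re * z.im := by
      rw [im_sqPhase, mul_div_cancel₀ _ hN.ne']
    have h3 : Complex.normSq (shear t z) =
        Complex.normSq z + t * (2 * z.re * z.im) + t ^ 2 * z.im ^ 2 := by
      simp [shear, Complex.normSq_apply]
      ring
    have h4 : z.im ^ 2 ≤ Complex.normSq z := by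
      rw [Complex.normSq_apply]
      nlinarith [sq_nonneg z.re]
    rw [h3, ← h2]
    nlinarith [mul_le_mul_of_nonneg_left h4 (sq_nonneg t)]
  exact h1.trans (mul_le_mul_of_nonneg_left (Real.add_one_le_exp _) hN.le)

/-- For |t| ≤ 1/2 the shear at most halves the modulus, so the difference quotient is controlled;
for larger |t| the trivial bound 2 suffices. -/
theorem norm_sqPhase_shear_sub_le (t : ℝ) {z : ℂ} (hz : z ≠ 0) :
    ‖sqPhase (shear t z) - sqPhase z‖ ≤ 4 * |t| := by
  rcases le_total |t| (1 / 2) with ht | ht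
  · have hN : 0 < ‖z‖ := norm_pos_iff.2 hz
    have hs := shear_ne_zero t hz
    have hd : ‖((t * z.im : ℝ) : ℂ)‖ ≤ |t| * ‖z‖ := by
      rw [Complex.norm_real, Real.norm_eq_abs, abs_mul]
      exact mul_le_mul_of_nonneg_left (Complex.abs_im_le_norm z) (abs_nonneg t)
    have hs2 : ‖z‖ / 2 ≤ ‖shear t z‖ := by
      have := norm_sub_le (shear t z) ((t * z.im : ℝ) : ℂ)
      rw [shear, add_sub_cancel_right] at this
      rw [shear]
      nlinarith
    have hc : (starRingEnd ℂ) z ≠ 0 := (map_ne_zero _).2 hz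
    have hcs : (starRingEnd ℂ) (shear t z) ≠ 0 := (map_ne_zero _).2 hs
    have e : sqPhase (shear t z) - sqPhase z =
        ((t * z.im : ℝ) : ℂ) * ((starRingEnd ℂ) z - z) /
          ((starRingEnd ℂ) (shear t z) * (starRingEnd ℂ) z) := by
      rw [sqPhase, sqPhase, div_sub_div _ _ hcs hc]
      congr 1
      rw [shear, map_add, Complex.conj_ofReal]
      ring
    rw [e, norm_div, norm_mul, norm_mul, Complex.norm_conj, Complex.norm_conj,
      div_le_iff₀ (mul_pos (norm_pos_iff.2 hs) hN)]
    have h2 : ‖(starRingEnd ℂ) z - z‖ ≤ 2 * ‖z‖ := by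
      refine (norm_sub_le _ _).trans ?_
      rw [Complex.norm_conj]
      linarith
    calc ‖((t * z.im : ℝ) : ℂ)‖ * ‖(starRingEnd ℂ) z - z‖ ≤ (|t| * ‖z‖) * (2 * ‖z‖) :=
          mul_le_mul hd h2 (norm_nonneg _) (by positivity)
      _ = 4 * |t| * (‖z‖ / 2 * ‖z‖) := by ring
      _ ≤ 4 * |t| * (‖shear t z‖ * ‖z‖) := by gcongr
  · refine (norm_sub_le _ _).trans ?_
    rw [norm_sqPhase hz, norm_sqPhase (shear_ne_zero t hz)]
    linarith

/-! ### Oscillating sums with harmonic weights -/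

/-- A null sequence that bounds the tails of `∑ g k / (k + 1)`. -/
noncomputable def tailBound (g : ℕ → ℝ) (m : ℕ) : ℝ :=
  2 / ((m : ℝ) + 1) + ∑' k, g (k + m) / (((k + m : ℕ) : ℝ) + 1)

theorem tailBound_nonneg {g : ℕ → ℝ} (hg0 : ∀ k, 0 ≤ g k) (m : ℕ) : 0 ≤ tailBound g m :=
  add_nonneg (by positivity) (tsum_nonneg fun k => div_nonneg (hg0 _) (by positivity))

theorem tendsto_tailBound (g : ℕ → ℝ) : Tendsto (tailBound g) atTop (𝓝 0) := by
  have h1 : Tendsto (fun m : ℕ => 2 / ((m : ℝ) + 1)) atTop (𝓝 0) :=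
    tendsto_const_nhds.div_atTop
      (tendsto_atTop_add_const_right _ _ tendsto_natCast_atTop_atTop)
  have h2 := h1.add (tendsto_sum_nat_add fun k => g k / ((k : ℝ) + 1))
  rwa [add_zero] at h2

theorem tailBound_antitone {g : ℕ → ℝ} (hg0 : ∀ k, 0 ≤ g k)
    (hg : Summable fun k => g k / ((k : ℝ) + 1)) : Antitone (tailBound g) := by
  refine antitone_nat_of_succ_le fun m => ?_
  have h1 : 2 / (((m + 1 : ℕ) : ℝ) + 1) ≤ 2 / ((m : ℝ) + 1) := by
    gcongr
    simp
  have h2 := ((summable_nat_add_iff m).2 hg).sum_add_tsum_nat_add 1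
  have h3 : 0 ≤ g m / ((m : ℝ) + 1) := div_nonneg (hg0 _) (by positivity)
  have h4 : ∑' k, g (k + 1 + m) / (((k + 1 + m : ℕ) : ℝ) + 1) =
      ∑' k, g (k + (m + 1)) / (((k + (m + 1) : ℕ) : ℝ) + 1) := by
    simp only [add_assoc, add_comm 1 m]
  simp only [Finset.sum_range_one, zero_add] at h2
  unfold tailBound
  linarith

/-- Summation by parts: a sum of `W k / (k + 1)` is small when `W` is nearly a
geometric sequence with a ratio different from `1`. -/
theorem norm_sum_div_le {W : ℕ → ℂ} {x : ℂ} {g : ℕ → ℝ} {D : ℝ} (hW : ∀ k, ‖W k‖ ≤ 1)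
    (hx : x ≠ 1) (hD : 0 ≤ D) (hg0 : ∀ k, 0 ≤ g k) (hg : Summable fun k => g k / (k + 1))
    (h : ∀ k, ‖W (k + 1) - x * W k‖ ≤ D * g k) (m n : ℕ) :
    ‖∑ k ∈ Finset.Ico m n, W k / ((k : ℂ) + 1)‖ ≤ (1 + D) / ‖x - 1‖ * tailBound g m := by
  rcases lt_or_ge n m with hnm | hmn
  · rw [Finset.Ico_eq_empty_of_le hnm.le, Finset.sum_empty, norm_zero]
    exact mul_nonneg (by positivity) (tailBound_nonneg hg0 m)
  -- With the boundary term moved to the left, each induction step costs 1/(n+1) - 1/(n+2), which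
  -- telescopes, plus the defect D g n / (n+1).
  have key : ‖(x - 1) * ∑ k ∈ Finset.Ico m n, W k / ((k : ℂ) + 1) - W n / ((n : ℂ) + 1)‖ ≤
      2 / ((m : ℝ) + 1) - 1 / ((n : ℝ) + 1) + D * ∑ k ∈ Finset.Ico m n, g k / ((k : ℝ) + 1) := by
    induction n, hmn using Nat.le_induction with
    | base =>
      have hm : (0 : ℝ) < (m : ℝ) + 1 := by positivity
      have e : ‖(m : ℂ) + 1‖ = (m : ℝ) + 1 := by
        rw [← Nat.cast_succ, Complex.norm_natCast, Nat.cast_succ]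
      simp only [Finset.Ico_self, Finset.sum_empty, mul_zero, zero_sub, norm_neg, add_zero]
      rw [norm_div, e, ← sub_div]
      gcongr
      linarith [hW m]
    | succ n hmn ih =>
      rw [Finset.sum_Ico_succ_top hmn, Finset.sum_Ico_succ_top hmn]
      have hn1 : (n : ℂ) + 1 ≠ 0 := Nat.cast_add_one_ne_zero n
      have hn2 : (n : ℂ) + 1 + 1 ≠ 0 := by exact_mod_cast Nat.cast_add_one_ne_zero (R := ℂ) (n + 1)
      have e : ‖(n : ℂ) + 1‖ = (n : ℝ) + 1 := by
        rw [← Nat.cast_succ, Complex.norm_natCast, Nat.cast_succ]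
      set S := ∑ k ∈ Finset.Ico m n, W k / ((k : ℂ) + 1)
      have hid : (x - 1) * (S + W n / ((n : ℂ) + 1)) - W (n + 1) / (((n + 1 : ℕ) : ℂ) + 1) =
          ((x - 1) * S - W n / ((n : ℂ) + 1)) - (W (n + 1) - x * W n) / ((n : ℂ) + 1) +
            W (n + 1) * ((1 / ((n : ℝ) + 1) - 1 / ((n : ℝ) + 1 + 1) : ℝ) : ℂ) := by
        push_cast
        field_simp
        ring
      have hpos : (0 : ℝ) ≤ 1 / ((n : ℝ) + 1) - 1 / ((n : ℝ) + 1 + 1) :=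
        sub_nonneg.2 (one_div_le_one_div_of_le (by positivity) (by linarith))
      rw [hid]
      refine (norm_add_le _ _).trans ?_
      have t1 := norm_sub_le ((x - 1) * S - W n / ((n : ℂ) + 1))
        ((W (n + 1) - x * W n) / ((n : ℂ) + 1))
      have t2 : ‖(W (n + 1) - x * W n) / ((n : ℂ) + 1)‖ ≤ D * (g n / ((n : ℝ) + 1)) := by
        rw [norm_div, e, ← mul_div_assoc]
        gcongr
        exact h n
      have t3 : ‖W (n + 1) * ((1 / ((n : ℝ) + 1) - 1 / ((n : ℝ) + 1 + 1) : ℝ) : ℂ)‖ ≤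
          1 / ((n : ℝ) + 1) - 1 / ((n : ℝ) + 1 + 1) := by
        rw [norm_mul, Complex.norm_real, Real.norm_of_nonneg hpos]
        exact mul_le_of_le_one_left hpos (hW _)
      rw [Nat.cast_succ (R := ℝ), mul_add]
      linarith
  have hx' : 0 < ‖x - 1‖ := norm_pos_iff.2 (sub_ne_zero.2 hx)
  have e : ‖(n : ℂ) + 1‖ = (n : ℝ) + 1 := by
    rw [← Nat.cast_succ, Complex.norm_natCast, Nat.cast_succ]
  have t1 : ‖W n / ((n : ℂ) + 1)‖ ≤ 1 / ((n : ℝ) + 1) := by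
    rw [norm_div, e]
    gcongr
    exact hW n
  have t2 : ∑ k ∈ Finset.Ico m n, g k / ((k : ℝ) + 1) ≤
      ∑' k, g (k + m) / ((k + m : ℕ) + 1) := by
    rw [Finset.sum_Ico_eq_sum_range]
    have := ((summable_nat_add_iff m).2 hg).sum_le_tsum (Finset.range (n - m))
      (fun k _ => div_nonneg (hg0 _) (by positivity))
    simpa [add_comm] using this
  have t3 : 0 ≤ ∑' k, g (k + m) / (((k + m : ℕ) : ℝ) + 1) :=
    tsum_nonneg fun k => div_nonneg (hg0 _) (by positivity)
  have t4 : ‖(x - 1) * ∑ k ∈ Finset.Ico m n, W k / ((k : ℂ) + 1)‖ ≤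
      (1 + D) * tailBound g m := by
    rw [tailBound]
    have t5 := norm_add_le ((x - 1) * ∑ k ∈ Finset.Ico m n, W k / ((k : ℂ) + 1) -
      W n / ((n : ℂ) + 1)) (W n / ((n : ℂ) + 1))
    rw [sub_add_cancel] at t5
    have t6 : 0 ≤ D * (2 / ((m : ℝ) + 1)) := by positivity
    have t7 := mul_le_mul_of_nonneg_left t2 hD
    nlinarith
  rw [norm_mul] at t4
  rw [div_mul_eq_mul_div, le_div_iff₀ hx']
  linarith

/-- Products of nearly geometric unimodular sequences are again nearly geometric, the ratios being
multiplied and the defects added. -/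
theorem norm_mul_sub_mul_le {P P' R R' p r : ℂ} (hP' : ‖P'‖ = 1) (hR : ‖R‖ = 1) (hr : ‖r‖ = 1) :
    ‖P' * R' - p * r * (P * R)‖ ≤ ‖P' - p * P‖ + ‖R' - r * R‖ := by
  have e : P' * R' - p * r * (P * R) = (P' - p * P) * (r * R) + P' * (R' - r * R) := by ring
  rw [e]
  refine (norm_add_le _ _).trans ?_
  rw [norm_mul, norm_mul, norm_mul, hr, hR, hP']
  simp

theorem abs_re_sum_div_le (W : ℕ → ℂ) (m n : ℕ) :
    |∑ k ∈ Finset.Ico m n, (W k).re / ((k : ℝ) + 1)| ≤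
      ‖∑ k ∈ Finset.Ico m n, W k / ((k : ℂ) + 1)‖ := by
  have e : ∑ k ∈ Finset.Ico m n, (W k).re / ((k : ℝ) + 1) =
      (∑ k ∈ Finset.Ico m n, W k / ((k : ℂ) + 1)).re := by
    rw [Complex.re_sum]
    refine Finset.sum_congr rfl fun k _ => ?_
    rw [← Nat.cast_succ, ← Nat.cast_succ, Complex.div_natCast_re]
  rw [e]
  exact Complex.abs_re_le_norm _

section Pair

variable {P R : ℕ → ℂ} {p r : ℂ} {A B : ℝ} {g : ℕ → ℝ}

/-- Two unimodular sequences that rotate with non-resonant frequencies are almost orthogonal. -/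
theorem abs_sum_im_mul_im_le (hg0 : ∀ k, 0 ≤ g k) (hg : Summable fun k => g k / ((k : ℝ) + 1))
    (hA : 0 ≤ A) (hB : 0 ≤ B) (hP : ∀ k, ‖P k‖ = 1) (hR : ∀ k, ‖R k‖ = 1) (hr : ‖r‖ = 1)
    (hPs : ∀ k, ‖P (k + 1) - p * P k‖ ≤ A * g k) (hRs : ∀ k, ‖R (k + 1) - r * R k‖ ≤ B * g k)
    (h1 : p * r ≠ 1) (h2 : p * (starRingEnd ℂ) r ≠ 1) (m n : ℕ) :
    |∑ k ∈ Finset.Ico m n, (P k).im * (R k).im / ((k : ℝ) + 1)| ≤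
      (1 + (A + B)) * (1 / ‖p * (starRingEnd ℂ) r - 1‖ + 1 / ‖p * r - 1‖) * tailBound g m := by
  have b1 := (abs_re_sum_div_le (fun k => P k * R k) m n).trans
    (norm_sum_div_le (fun k => by simp [hP, hR]) h1 (add_nonneg hA hB) hg0 hg
      (fun k => (norm_mul_sub_mul_le (hP (k + 1)) (hR k) hr).trans
        ((add_le_add (hPs k) (hRs k)).trans_eq (add_mul _ _ _).symm)) m n)
  have hRs' : ∀ k, ‖(starRingEnd ℂ) (R (k + 1)) - (starRingEnd ℂ) r * (starRingEnd ℂ) (R k)‖ ≤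
      B * g k := fun k => by
    rw [← map_mul, ← map_sub, Complex.norm_conj]
    exact hRs k
  have b2 := (abs_re_sum_div_le (fun k => P k * (starRingEnd ℂ) (R k)) m n).trans
    (norm_sum_div_le (fun k => by simp [hP, hR]) h2 (add_nonneg hA hB) hg0 hg
      (fun k => (norm_mul_sub_mul_le (hP (k + 1)) (by rw [Complex.norm_conj, hR k])
        (by rw [Complex.norm_conj, hr])).trans
        ((add_le_add (hPs k) (hRs' k)).trans_eq (add_mul _ _ _).symm)) m n)
  -- Product-to-sum formula: Im P Im R = (Re(P R̄) - Re(P R)) / 2, hence the two non-resonance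
  -- conditions.
  have e : ∑ k ∈ Finset.Ico m n, (P k).im * (R k).im / ((k : ℝ) + 1) =
      (∑ k ∈ Finset.Ico m n, (P k * (starRingEnd ℂ) (R k)).re / ((k : ℝ) + 1) -
        ∑ k ∈ Finset.Ico m n, (P k * R k).re / ((k : ℝ) + 1)) / 2 := by
    rw [← Finset.sum_sub_distrib, Finset.sum_div]
    refine Finset.sum_congr rfl fun k _ => ?_
    simp only [Complex.mul_re, Complex.conj_re, Complex.conj_im]
    ring
  rw [e, abs_div, abs_two]
  have b3 := abs_sub (∑ k ∈ Finset.Ico m n, (P k * (starRingEnd ℂ) (R k)).re / ((k : ℝ) + 1))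
    (∑ k ∈ Finset.Ico m n, (P k * R k).re / ((k : ℝ) + 1))
  have e2 : (1 + (A + B)) * (1 / ‖p * (starRingEnd ℂ) r - 1‖ + 1 / ‖p * r - 1‖) * tailBound g m =
      (1 + (A + B)) / ‖p * (starRingEnd ℂ) r - 1‖ * tailBound g m +
        (1 + (A + B)) / ‖p * r - 1‖ * tailBound g m := by ring
  rw [e2]
  have b4 := abs_nonneg (∑ k ∈ Finset.Ico m n, (P k * (starRingEnd ℂ) (R k)).re / ((k : ℝ) + 1))
  have b5 := abs_nonneg (∑ k ∈ Finset.Ico m n, (P k * R k).re / ((k : ℝ) + 1))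
  linarith

/-- The mean of `(Im P)²` along a unimodular sequence that rotates non-resonantly is `1 / 2`. -/
theorem le_sum_im_mul_im (hg0 : ∀ k, 0 ≤ g k) (hg : Summable fun k => g k / ((k : ℝ) + 1))
    (hA : 0 ≤ A) (hP : ∀ k, ‖P k‖ = 1) (hp : ‖p‖ = 1)
    (hPs : ∀ k, ‖P (k + 1) - p * P k‖ ≤ A * g k) (h1 : p * p ≠ 1) (m n : ℕ) :
    (∑ k ∈ Finset.Ico m n, 1 / ((k : ℝ) + 1)) / 2 -
        (1 + (A + A)) / ‖p * p - 1‖ * tailBound g m ≤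
      ∑ k ∈ Finset.Ico m n, (P k).im * (P k).im / ((k : ℝ) + 1) := by
  have b1 := (abs_re_sum_div_le (fun k => P k * P k) m n).trans
    (norm_sum_div_le (fun k => by simp [hP]) h1 (add_nonneg hA hA) hg0 hg
      (fun k => (norm_mul_sub_mul_le (hP (k + 1)) (hP k) hp).trans
        ((add_le_add (hPs k) (hPs k)).trans_eq (add_mul _ _ _).symm)) m n)
  have e : ∑ k ∈ Finset.Ico m n, (P k).im * (P k).im / ((k : ℝ) + 1) =
      (∑ k ∈ Finset.Ico m n, 1 / ((k : ℝ) + 1) -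
        ∑ k ∈ Finset.Ico m n, (P k * P k).re / ((k : ℝ) + 1)) / 2 := by
    rw [← Finset.sum_sub_distrib, Finset.sum_div]
    refine Finset.sum_congr rfl fun k _ => ?_
    have h : (P k).re * (P k).re + (P k).im * (P k).im = 1 := by
      rw [← Complex.normSq_apply, Complex.normSq_eq_norm_sq, hP, one_pow]
    rw [Complex.mul_re, ← h]
    ring
  rw [e]
  have b2 := le_abs_self (∑ k ∈ Finset.Ico m n, (P k * P k).re / ((k : ℝ) + 1))
  have b3 := abs_nonneg (∑ k ∈ Finset.Ico m n, (P k * P k).re / ((k : ℝ) + 1))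
  linarith

end Pair

/-- Since exp(1/(n+1)) ≥ (n+2)/(n+1), the product telescopes. This turns harmonic damping into power
decay. -/
theorem exp_neg_sum_le (m n : ℕ) (hmn : m ≤ n) :
    Real.exp (-∑ k ∈ Finset.Ico m n, 1 / ((k : ℝ) + 1)) ≤ ((m : ℝ) + 1) / ((n : ℝ) + 1) := by
  induction n, hmn using Nat.le_induction with
  | base =>
    have : (m : ℝ) + 1 ≠ 0 := by positivity
    simp [div_self this]
  | succ n hmn ih =>
    rw [Finset.sum_Ico_succ_top hmn, neg_add, Real.exp_add]
    have h1 : Real.exp (-(1 / ((n : ℝ) + 1))) ≤ ((n : ℝ) + 1) / (((n + 1 : ℕ) : ℝ) + 1) := by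
      rw [Real.exp_neg, inv_le_comm₀ (Real.exp_pos _) (by positivity), inv_div]
      refine le_trans (le_of_eq ?_) (Real.add_one_le_exp _)
      push_cast
      field_simp
      ring
    calc _ ≤ ((m : ℝ) + 1) / ((n : ℝ) + 1) * (((n : ℝ) + 1) / (((n + 1 : ℕ) : ℝ) + 1)) :=
          mul_le_mul ih h1 (Real.exp_pos _).le (by positivity)
      _ = _ := by
        push_cast
        field_simp

/-! ### The feedback and the decay of all modes -/

/-- The feedback that makes each mode `j`, from time `s j` on, decay. -/
noncomputable def feedback (C : ℕ → ℝ) (s : ℕ → ℕ) (k : ℕ) (z : ℕ → ℂ) : ℝ :=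
  -(∑ j ∈ Finset.range (k + 1), if s j ≤ k then C j * (sqPhase (z j)).im else 0) / ((k : ℝ) + 1)

/-- The modes under the feedback: at each time step, a shear followed by a rotation. -/
noncomputable def controlledModes (α C : ℕ → ℝ) (s : ℕ → ℕ) (x z₀ : ℕ → ℂ) : ℕ → ℕ → ℂ
  | 0 => z₀
  | k + 1 => fun i => x i *
      shear (feedback C s k (controlledModes α C s x z₀ k) * α i) (controlledModes α C s x z₀ k i)

/-- Each active mode j may use the share 2^{-(j+1)} of the amplitude μ k, and the shares add up to
at most 1. -/
theorem abs_feedback_le {C : ℕ → ℝ} {s : ℕ → ℕ} {μ : ℕ → ℝ} (hμ : ∀ k, 0 ≤ μ k)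
    (hs : ∀ j, ∀ k ≥ s j, |C j| ≤ (1 / 2) ^ (j + 1) * (((k : ℝ) + 1) * μ k))
    (k : ℕ) {z : ℕ → ℂ} (hz : ∀ j, z j ≠ 0) : |feedback C s k z| ≤ μ k := by
  have hk : (0 : ℝ) < (k : ℝ) + 1 := by positivity
  rw [feedback, abs_div, abs_neg, abs_of_pos hk, div_le_iff₀ hk, mul_comm (μ k)]
  have hM : 0 ≤ ((k : ℝ) + 1) * μ k := mul_nonneg hk.le (hμ k)
  have h1 : ∀ j ∈ Finset.range (k + 1), |if s j ≤ k then C j * (sqPhase (z j)).im else 0| ≤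
      (1 / 2) ^ (j + 1) * (((k : ℝ) + 1) * μ k) := by
    intro j _
    split_ifs with h
    · rw [abs_mul]
      refine le_trans (mul_le_of_le_one_right (abs_nonneg _) ?_) (hs j k h)
      exact (Complex.abs_im_le_norm _).trans_eq (norm_sqPhase (hz j))
    · rw [abs_zero]
      positivity
  refine (Finset.abs_sum_le_sum_abs _ _).trans ((Finset.sum_le_sum h1).trans ?_)
  rw [← Finset.sum_mul]
  refine mul_le_of_le_one_left hM ?_
  have h2 : ∑ j ∈ Finset.range (k + 1), (1 / 2 : ℝ) ^ (j + 1) =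
      (∑ j ∈ Finset.range (k + 1), (1 / 2 : ℝ) ^ j) / 2 := by
    rw [Finset.sum_div]
    exact Finset.sum_congr rfl fun j _ => by ring
  rw [h2]
  linarith [sum_geometric_two_le (k + 1)]

theorem summable_div_of_summable_sq {μ : ℕ → ℝ} (hμ : ∀ k, 0 ≤ μ k)
    (hμ2 : Summable fun k => μ k ^ 2) : Summable fun k => μ k / ((k : ℝ) + 1) := by
  have h1 : Summable fun k : ℕ => (1 / ((k : ℝ) + 1)) ^ 2 := by
    have := (summable_nat_add_iff 1).2 (Real.summable_one_div_nat_pow.2 one_lt_two)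
    simpa [div_pow] using this
  refine Summable.of_nonneg_of_le (fun k => div_nonneg (hμ k) (by positivity)) (fun k => ?_)
    (hμ2.add h1)
  rw [div_eq_mul_one_div]
  nlinarith [sq_nonneg (μ k - 1 / ((k : ℝ) + 1)), sq_nonneg (μ k), sq_nonneg (1 / ((k : ℝ) + 1))]

section Dynamics

variable {α C μ : ℕ → ℝ} {s : ℕ → ℕ} {x : ℕ → ℂ} {z : ℕ → ℕ → ℂ} {c : ℕ → ℝ}

theorem sum_feedback_mul_im_eq (hc : ∀ k, c k = feedback C s k (z k))
    (hsi : ∀ j, j ≤ s j) (i n : ℕ) :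
    ∑ k ∈ Finset.Ico (s i) n, c k * α i * (sqPhase (z k i)).im =
      -∑ j ∈ Finset.range n, C j * α i * ∑ k ∈ Finset.Ico (max (s i) (s j)) n,
        (sqPhase (z k j)).im * (sqPhase (z k i)).im / ((k : ℝ) + 1) := by
  have e1 : ∀ k ∈ Finset.Ico (s i) n, c k * α i * (sqPhase (z k i)).im =
      -∑ j ∈ Finset.range n, if s j ≤ k then
        C j * α i * ((sqPhase (z k j)).im * (sqPhase (z k i)).im / ((k : ℝ) + 1)) else 0 := by
    intro k hk
    have hkn := (Finset.mem_Ico.1 hk).2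
    -- Modes j > k are inactive at time k because j ≤ s j, so the range of j can be made independent
    -- of k before the sums are exchanged.
    have e2 : ∑ j ∈ Finset.range (k + 1), (if s j ≤ k then C j * (sqPhase (z k j)).im else 0) =
        ∑ j ∈ Finset.range n, if s j ≤ k then C j * (sqPhase (z k j)).im else 0 := by
      refine Finset.sum_subset (Finset.range_mono hkn) fun j _ hj => if_neg fun h => hj ?_
      exact Finset.mem_range.2 (Nat.lt_succ_of_le ((hsi j).trans h))
    rw [hc, feedback, e2, neg_div, neg_mul, neg_mul, Finset.sum_div, Finset.sum_mul,
      Finset.sum_mul]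
    congr 1
    refine Finset.sum_congr rfl fun j _ => ?_
    split_ifs
    · ring
    · simp
  rw [Finset.sum_congr rfl e1, Finset.sum_neg_distrib, Finset.sum_comm]
  congr 1
  refine Finset.sum_congr rfl fun j _ => ?_
  rw [Finset.mul_sum, ← Finset.sum_filter]
  refine Finset.sum_congr ?_ fun _ _ => rfl
  ext k
  simp only [Finset.mem_filter, Finset.mem_Ico, max_le_iff]
  tauto

theorem norm_sqPhase_step_le (hx : ∀ i, ‖x i‖ = 1) (hz0 : ∀ k i, z k i ≠ 0)
    (hz : ∀ k i, z (k + 1) i = x i * shear (c k * α i) (z k i)) (hcμ : ∀ k, |c k| ≤ μ k)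
    (i k : ℕ) : ‖sqPhase (z (k + 1) i) - x i ^ 2 * sqPhase (z k i)‖ ≤ 4 * |α i| * μ k := by
  rw [hz, sqPhase_mul _ _ (hx i), ← mul_sub, norm_mul, norm_pow, hx i, one_pow, one_mul]
  refine (norm_sqPhase_shear_sub_le _ (hz0 k i)).trans ?_
  rw [abs_mul]
  nlinarith [mul_le_mul_of_nonneg_right (hcμ k) (abs_nonneg (α i))]

theorem normSq_le_mul_exp_sum (hx : ∀ i, ‖x i‖ = 1) (hz0 : ∀ k i, z k i ≠ 0)
    (hz : ∀ k i, z (k + 1) i = x i * shear (c k * α i) (z k i)) (i m n : ℕ) (hmn : m ≤ n) :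
    Complex.normSq (z n i) ≤ Complex.normSq (z m i) * Real.exp (∑ k ∈ Finset.Ico m n,
      (c k * α i * (sqPhase (z k i)).im + (c k * α i) ^ 2)) := by
  induction n, hmn using Nat.le_induction with
  | base => simp
  | succ n hmn ih =>
    rw [Finset.sum_Ico_succ_top hmn, Real.exp_add, hz, Complex.normSq_mul,
      Complex.normSq_eq_norm_sq (x i), hx, one_pow, one_mul, ← mul_assoc]
    exact (normSq_shear_le _ (hz0 n i)).trans
      (mul_le_mul_of_nonneg_right ih (Real.exp_pos _).le)

/-- A bound for the influence of the feedback for mode `j` on the mode `i`. -/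
noncomputable def coupling (α C : ℕ → ℝ) (x : ℕ → ℂ) (i j : ℕ) : ℝ :=
  |C j * α i| * ((1 + (4 * |α j| + 4 * |α i|)) *
    (1 / ‖x j ^ 2 * (starRingEnd ℂ) (x i ^ 2) - 1‖ + 1 / ‖x j ^ 2 * x i ^ 2 - 1‖))

theorem coupling_nonneg (α C : ℕ → ℝ) (x : ℕ → ℂ) (i j : ℕ) : 0 ≤ coupling α C x i j := by
  unfold coupling
  positivity

/-- The diagonal term has weight 4 and mean 1/2, whence the factor 2. The off-diagonal terms are
bounded uniformly in n by a sequence summable in j, so `F` does not depend on n. -/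
theorem exists_sum_feedback_le (hx : ∀ i, ‖x i‖ = 1) (h1 : ∀ i j, x i ^ 2 * x j ^ 2 ≠ 1)
    (h2 : ∀ i j, i ≠ j → x i ^ 2 ≠ x j ^ 2) (hμ : ∀ k, 0 ≤ μ k)
    (hμ1 : Summable fun k => μ k / ((k : ℝ) + 1)) (hz0 : ∀ k i, z k i ≠ 0)
    (hz : ∀ k i, z (k + 1) i = x i * shear (c k * α i) (z k i)) (hcμ : ∀ k, |c k| ≤ μ k)
    (hc : ∀ k, c k = feedback C s k (z k)) (hsi : ∀ j, j ≤ s j) (hC : ∀ i, C i * α i = 4)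
    (hs : ∀ j, ∀ i < j, coupling α C x i j * tailBound μ (s j) ≤ (1 / 2) ^ j) (i : ℕ) :
    ∃ F : ℝ, ∀ n, s i < n → ∑ k ∈ Finset.Ico (s i) n, c k * α i * (sqPhase (z k i)).im ≤
      F - 2 * ∑ k ∈ Finset.Ico (s i) n, 1 / ((k : ℝ) + 1) := by
  have hsum : Summable fun j => coupling α C x i j * tailBound μ (s j) := by
    -- The smallness `hs` covers only j > i; the finitely many other modes are split off.
    rw [← summable_nat_add_iff (i + 1)]
    refine Summable.of_nonneg_of_le
      (fun j => mul_nonneg (coupling_nonneg _ _ _ _ _) (tailBound_nonneg hμ _))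
      (fun j => hs _ _ (by omega)) ?_
    exact (summable_nat_add_iff (i + 1)).2 summable_geometric_two
  have hstep := norm_sqPhase_step_le hx hz0 hz hcμ
  have hx2 : ∀ j, ‖x j ^ 2‖ = 1 := fun j => by rw [norm_pow, hx, one_pow]
  refine ⟨∑' j, coupling α C x i j * tailBound μ (s j) +
    4 * ((1 + (4 * |α i| + 4 * |α i|)) / ‖x i ^ 2 * x i ^ 2 - 1‖ * tailBound μ (s i)),
    fun n hn => ?_⟩
  rw [sum_feedback_mul_im_eq hc hsi, ← Finset.add_sum_erase _ _
    (Finset.mem_range.2 ((hsi i).trans_lt hn)), hC, max_self]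
  have b1 := le_sum_im_mul_im hμ hμ1 (by positivity) (fun k => norm_sqPhase (hz0 k i)) (hx2 i)
    (hstep i) (h1 i i) (s i) n
  have b2 : ∀ j ∈ (Finset.range n).erase i, -(coupling α C x i j * tailBound μ (s j)) ≤
      C j * α i * ∑ k ∈ Finset.Ico (max (s i) (s j)) n,
        (sqPhase (z k j)).im * (sqPhase (z k i)).im / ((k : ℝ) + 1) := by
    intro j hj
    have hji := Finset.ne_of_mem_erase hj
    have h3 : x j ^ 2 * (starRingEnd ℂ) (x i ^ 2) ≠ 1 := by
      intro h
      rw [← Complex.inv_eq_conj (hx2 i)] at h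
      exact h2 j i hji (eq_of_mul_inv_eq_one h)
    have b3 := abs_sum_im_mul_im_le hμ hμ1 (by positivity) (by positivity)
      (fun k => norm_sqPhase (hz0 k j)) (fun k => norm_sqPhase (hz0 k i)) (hx2 i)
      (hstep j) (hstep i) (h1 j i) h3 (max (s i) (s j)) n
    have b4 : tailBound μ (max (s i) (s j)) ≤ tailBound μ (s j) :=
      tailBound_antitone hμ hμ1 (le_max_right _ _)
    refine (neg_le_neg ?_).trans (neg_abs_le _)
    rw [abs_mul, coupling, mul_assoc]
    refine mul_le_mul_of_nonneg_left (b3.trans ?_) (abs_nonneg _)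
    exact mul_le_mul_of_nonneg_left b4 (by positivity)
  have b5 := Finset.sum_le_sum b2
  rw [Finset.sum_neg_distrib] at b5
  have b6 := hsum.sum_le_tsum ((Finset.range n).erase i)
    (fun j _ => mul_nonneg (coupling_nonneg _ _ _ _ _) (tailBound_nonneg hμ _))
  linarith

end Dynamics

/-- For each j there are only finitely many i < j, and every condition holds for all late times:
(k+1) μ k tends to infinity and `tailBound` tends to 0. -/
theorem exists_activation_times (C μ : ℕ → ℝ) (G : ℕ → ℕ → ℝ)
    (hμ3 : Tendsto (fun k : ℕ => ((k : ℝ) + 1) * μ k) atTop atTop) :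
    ∃ s : ℕ → ℕ, (∀ j, j ≤ s j) ∧
      (∀ j, ∀ k ≥ s j, |C j| ≤ (1 / 2) ^ (j + 1) * (((k : ℝ) + 1) * μ k)) ∧
      ∀ j, ∀ i < j, G i j * tailBound μ (s j) ≤ (1 / 2) ^ j := by
  have h : ∀ j : ℕ, ∃ m : ℕ, j ≤ m ∧
      (∀ k ≥ m, |C j| ≤ (1 / 2) ^ (j + 1) * (((k : ℝ) + 1) * μ k)) ∧
      ∀ i < j, G i j * tailBound μ m ≤ (1 / 2) ^ j := by
    intro j
    have e1 : ∀ᶠ m in atTop, j ≤ m := eventually_ge_atTop j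
    have e2 : ∀ᶠ m : ℕ in atTop, ∀ k ≥ m, |C j| ≤ (1 / 2) ^ (j + 1) * (((k : ℝ) + 1) * μ k) :=
      eventually_forall_ge_atTop.2 ((hμ3.const_mul_atTop
        (by positivity : (0 : ℝ) < (1 / 2) ^ (j + 1))).eventually_ge_atTop |C j|)
    have e3 : ∀ᶠ m in atTop, ∀ i < j, G i j * tailBound μ m ≤ (1 / 2) ^ j := by
      have : ∀ᶠ m in atTop, ∀ i ∈ Finset.range j, G i j * tailBound μ m ≤ (1 / 2) ^ j := by
        rw [Filter.eventually_all_finset]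
        intro i _
        have := (tendsto_tailBound μ).const_mul (G i j)
        rw [mul_zero] at this
        exact this.eventually_le_const (by positivity)
      simpa using this
    exact (e1.and (e2.and e3)).exists
  choose s hs using h
  exact ⟨s, fun j => (hs j).1, fun j => (hs j).2.1, fun j => (hs j).2.2⟩

/-- A single small sequence of shears makes countably many non-resonant rotations decay. -/
theorem exists_shears_summable_normSq {α μ : ℕ → ℝ} {x z₀ : ℕ → ℂ} (hα : ∀ i, α i ≠ 0)
    (hx : ∀ i, ‖x i‖ = 1) (h1 : ∀ i j, x i ^ 2 * x j ^ 2 ≠ 1)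
    (h2 : ∀ i j, i ≠ j → x i ^ 2 ≠ x j ^ 2) (hz₀ : ∀ i, z₀ i ≠ 0) (hμ : ∀ k, 0 ≤ μ k)
    (hμ2 : Summable fun k => μ k ^ 2)
    (hμ3 : Tendsto (fun k : ℕ => ((k : ℝ) + 1) * μ k) atTop atTop) :
    ∃ c : ℕ → ℝ, (∀ k, |c k| ≤ μ k) ∧ ∃ z : ℕ → ℕ → ℂ, (∀ i, z 0 i = z₀ i) ∧
      (∀ k i, z (k + 1) i = x i * shear (c k * α i) (z k i)) ∧
      ∀ i, Summable fun k => Complex.normSq (z k i) := by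
  -- The gain 4 damps |z|² like exp(-2 ∑ 1/(k+1)), hence like k⁻², which is summable.
  set C : ℕ → ℝ := fun i => 4 / α i
  obtain ⟨s, hsi, hsC, hsG⟩ := exists_activation_times C μ (coupling α C x) hμ3
  set z := controlledModes α C s x z₀
  set c : ℕ → ℝ := fun k => feedback C s k (z k)
  have hz : ∀ k i, z (k + 1) i = x i * shear (c k * α i) (z k i) := fun k i => rfl
  have hz0 : ∀ k i, z k i ≠ 0 := by
    intro k
    induction k with
    | zero => exact hz₀
    | succ k ih =>
      intro i
      rw [hz]
      refine mul_ne_zero (norm_ne_zero_iff.1 ?_) (shear_ne_zero _ (ih i))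
      rw [hx]
      exact one_ne_zero
  have hcμ : ∀ k, |c k| ≤ μ k := fun k => abs_feedback_le hμ hsC k (hz0 k)
  have hμ1 := summable_div_of_summable_sq hμ hμ2
  refine ⟨c, hcμ, z, fun _ => rfl, hz, fun i => ?_⟩
  obtain ⟨F, hF⟩ := exists_sum_feedback_le hx h1 h2 hμ hμ1 hz0 hz hcμ (fun _ => rfl) hsi
    (fun i => div_mul_cancel₀ 4 (hα i)) hsG i
  have hc2 : Summable fun k => (c k * α i) ^ 2 := by
    refine Summable.of_nonneg_of_le (fun k => sq_nonneg _) (fun k => ?_) (hμ2.mul_right (α i ^ 2))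
    rw [mul_pow, ← sq_abs (c k)]
    gcongr
    exact hcμ k
  have hinv : Summable fun n : ℕ => (1 / ((n : ℝ) + 1)) ^ 2 := by
    have := (summable_nat_add_iff 1).2 (Real.summable_one_div_nat_pow.2 one_lt_two)
    simpa [div_pow] using this
  rw [← summable_nat_add_iff (s i + 1)]
  refine Summable.of_nonneg_of_le (fun n => Complex.normSq_nonneg _) (fun n => ?_)
    (((summable_nat_add_iff (s i + 1)).2 hinv).mul_left (Complex.normSq (z (s i) i) *
      Real.exp (F + ∑' k, (c k * α i) ^ 2) * ((s i : ℝ) + 1) ^ 2))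
  generalize hN : n + (s i + 1) = N
  have hsN : s i < N := by omega
  refine (normSq_le_mul_exp_sum hx hz0 hz i (s i) N hsN.le).trans ?_
  rw [mul_assoc, mul_assoc]
  refine mul_le_mul_of_nonneg_left ?_ (Complex.normSq_nonneg _)
  have t1 := hc2.sum_le_tsum (Finset.Ico (s i) N) (fun k _ => sq_nonneg _)
  have t2 := hF N hsN
  have t3 : ∑ k ∈ Finset.Ico (s i) N, (c k * α i * (sqPhase (z k i)).im + (c k * α i) ^ 2) ≤
      (F + ∑' k, (c k * α i) ^ 2) + 2 * (-∑ k ∈ Finset.Ico (s i) N, 1 / ((k : ℝ) + 1)) := by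
    rw [Finset.sum_add_distrib]
    linarith
  refine (Real.exp_le_exp.2 t3).trans ?_
  rw [Real.exp_add]
  refine mul_le_mul_of_nonneg_left ?_ (Real.exp_pos _).le
  have t4 := pow_le_pow_left₀ (Real.exp_pos _).le (exp_neg_sum_le (s i) N hsN.le) 2
  rw [← Real.exp_nat_mul] at t4
  refine le_trans (le_of_eq ?_) (t4.trans (le_of_eq ?_))
  · norm_num
  · rw [← mul_pow, mul_one_div]

/-! ### Non-resonance of the quasi-momenta -/

theorem add_eq_pi_of_exp_sq_mul_exp_sq {θ φ : ℝ} (hθ : θ ∈ Set.Ioo 0 π) (hφ : φ ∈ Set.Ioo 0 π)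
    (h : Complex.exp (Complex.I * θ) ^ 2 * Complex.exp (Complex.I * φ) ^ 2 = 1) : θ + φ = π := by
  rw [← Complex.exp_nat_mul, ← Complex.exp_nat_mul, ← Complex.exp_add,
    Complex.exp_eq_one_iff] at h
  obtain ⟨n, hn⟩ := h
  have h1 : ((θ + φ : ℝ) : ℂ) = ((n * π : ℝ) : ℂ) := by
    have h2 : (2 * Complex.I) * ((θ + φ : ℝ) : ℂ) = (2 * Complex.I) * ((n * π : ℝ) : ℂ) := by
      push_cast at hn ⊢
      linear_combination hn
    exact mul_left_cancel₀ (by simp) h2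
  have h3 : θ + φ = n * π := Complex.ofReal_injective h1
  have hn0 : (0 : ℝ) < n := by
    by_contra hcon
    nlinarith [hθ.1, hφ.1, pi_pos]
  have hn2 : (n : ℝ) < 2 := by
    by_contra hcon
    nlinarith [hθ.2, hφ.2, pi_pos]
  have hn1 : n = 1 := by
    have a1 : 0 < n := by exact_mod_cast hn0
    have a2 : n < 2 := by exact_mod_cast hn2
    omega
  rw [h3, hn1, Int.cast_one, one_mul]

theorem eq_of_exp_sq_eq_exp_sq {θ φ : ℝ} (hθ : θ ∈ Set.Ioo 0 π) (hφ : φ ∈ Set.Ioo 0 π)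
    (h : Complex.exp (Complex.I * θ) ^ 2 = Complex.exp (Complex.I * φ) ^ 2) : θ = φ := by
  rw [← Complex.exp_nat_mul, ← Complex.exp_nat_mul, Complex.exp_eq_exp_iff_exists_int] at h
  obtain ⟨n, hn⟩ := h
  have h1 : ((θ - φ : ℝ) : ℂ) = ((n * π : ℝ) : ℂ) := by
    have h2 : (2 * Complex.I) * ((θ - φ : ℝ) : ℂ) = (2 * Complex.I) * ((n * π : ℝ) : ℂ) := by
      push_cast at hn ⊢
      linear_combination hn
    exact mul_left_cancel₀ (by simp) h2
  have h3 : θ - φ = n * π := Complex.ofReal_injective h1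
  have hn0 : (-1 : ℝ) < n := by
    by_contra hcon
    nlinarith [hθ.1, hφ.2, pi_pos]
  have hn2 : (n : ℝ) < 1 := by
    by_contra hcon
    nlinarith [hθ.2, hφ.1, pi_pos]
  have hn1 : n = 0 := by
    have a1 : -1 < n := by exact_mod_cast hn0
    have a2 : n < 1 := by exact_mod_cast hn2
    omega
  rw [hn1, Int.cast_zero, zero_mul, sub_eq_zero] at h3
  exact h3

/-- The consequences of rational independence that exclude all resonances of order two. -/
theorem nonresonant_of_linearIndependent {θ : ℕ → ℝ} (hθ : ∀ i, θ i ∈ Set.Ioo 0 π)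
    (hind : ∀ n : ℕ, LinearIndependent ℚ
      (Fin.cons π (fun j : Fin n => θ ((j : ℕ) + 1)) : Fin (n + 1) → ℝ))
    {r : ℚ} (hr : θ 0 = r * π) (h0 : θ 0 ≠ π / 2) :
    (∀ i j, θ i + θ j ≠ π) ∧ Function.Injective θ := by
  have hmem : ∀ n (i : Fin n), θ ((i : ℕ) + 1) ∈
      Submodule.span ℚ (Set.range fun j : Fin n => θ ((j : ℕ) + 1)) :=
    fun n i => Submodule.subset_span ⟨i, rfl⟩
  have hA : ∀ i j, θ (i + 1) + θ (j + 1) ≠ π := by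
    intro i j h
    -- Otherwise π would lie in the span of the quasi-momenta; i + j + 1 of them are enough to
    -- include both indices, and i = j is allowed.
    refine (linearIndependent_finCons.1 (hind (i + j + 1))).2 ?_
    rw [← h]
    exact add_mem (hmem (i + j + 1) ⟨i, by omega⟩) (hmem (i + j + 1) ⟨j, by omega⟩)
  have hB : ∀ i j, θ (i + 1) = θ (j + 1) → i = j := by
    intro i j h
    have := (linearIndependent_finCons.1 (hind (i + j + 1))).1.injective
      (a₁ := ⟨i, by omega⟩) (a₂ := ⟨j, by omega⟩) h
    simpa using this
  have hC : ∀ i (t : ℚ), θ (i + 1) ≠ t * π := by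
    intro i t h
    have ht : t ≠ 0 := by
      rintro rfl
      rw [Rat.cast_zero, zero_mul] at h
      exact (hθ (i + 1)).1.ne' h
    refine (linearIndependent_finCons.1 (hind (i + 1))).2 ?_
    have e : π = t⁻¹ • θ (i + 1) := by
      rw [h, Rat.smul_def, Rat.cast_inv, inv_mul_cancel_left₀ (by exact_mod_cast ht)]
    rw [e]
    exact Submodule.smul_mem _ _ (hmem (i + 1) ⟨i, by omega⟩)
  have hD : ∀ i, θ 0 + θ (i + 1) ≠ π := by
    intro i h
    refine hC i (1 - r) ?_
    push_cast
    linarith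
  constructor
  · rintro (_ | i) (_ | j) h
    · exact h0 (by linarith)
    · exact hD j h
    · exact hD i (by linarith)
    · exact hA i j h
  · rintro (_ | i) (_ | j) h
    · rfl
    · exact (hC j r (by linarith)).elim
    · exact (hC i r (by linarith)).elim
    · rw [hB i j h]

/-! ### From the Jacobi recurrence to rotations and shears -/

/-- A real `2 × 2` matrix with a non-real eigenvalue acts as multiplication by that eigenvalue in
a suitable complex coordinate. -/
theorem exists_complex_coordinate (M : Matrix (Fin 2) (Fin 2) ℝ) (hdet : M.det = 1) {x : ℂ}
    (hx : x ^ 2 - (M.trace : ℂ) * x + 1 = 0) (him : x.im ≠ 0) :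
    ∃ l : ℂ, l.im ≠ 0 ∧ ∀ v : Fin 2 → ℝ,
      ((M.mulVec v 0 : ℝ) : ℂ) + l * (M.mulVec v 1 : ℝ) = x * (v 0 + l * v 1) := by
  rw [Matrix.det_fin_two] at hdet
  rw [Matrix.trace_fin_two] at hx
  have hd : (M 0 0 : ℂ) * M 1 1 - M 0 1 * M 1 0 = 1 := by exact_mod_cast hdet
  push_cast at hx
  have hfac : (x - M 0 0) * (x - M 1 1) = M 0 1 * M 1 0 := by linear_combination hx + hd
  have h10 : M 1 0 ≠ 0 := by
    intro h
    rw [h, Complex.ofReal_zero, mul_zero, mul_eq_zero, sub_eq_zero, sub_eq_zero] at hfac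
    rcases hfac with h' | h' <;> exact him (by rw [h', Complex.ofReal_im])
  have h10' : (M 1 0 : ℂ) ≠ 0 := by exact_mod_cast h10
  -- (1, l) is a left eigenvector of `M` for x; `M 1 0` is non-zero because otherwise x would be a
  -- real diagonal entry.
  refine ⟨(x - M 0 0) / M 1 0, ?_, fun v => ?_⟩
  · rw [Complex.div_ofReal_im, Complex.sub_im, Complex.ofReal_im, sub_zero]
    exact div_ne_zero him h10
  · simp only [Matrix.mulVec, dotProduct, Fin.sum_univ_two]
    push_cast
    field_simp
    linear_combination (-(v 1 : ℂ)) * hfac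

/-- The solution, with `u 0 = 0` and `u 1 = 1`, of the three-term recurrence of the Jacobi matrix
with the potential `q` added. -/
noncomputable def jacobiSolution (a b q : ℕ → ℝ) (x : ℝ) : ℕ → ℝ
  | 0 => 0
  | 1 => 1
  | n + 2 => ((x - b (n + 1) - q (n + 1)) * jacobiSolution a b q x (n + 1) -
      a n * jacobiSolution a b q x n) / a (n + 1)

section Solution

variable {a b q : ℕ → ℝ} {x : ℝ}

theorem jacobiSolution_add_two (n : ℕ) : jacobiSolution a b q x (n + 2) =
    ((x - b (n + 1) - q (n + 1)) * jacobiSolution a b q x (n + 1) -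
      a n * jacobiSolution a b q x n) / a (n + 1) := by
  rw [jacobiSolution]

/-- The value 0 at index 0 makes the first row an instance of the recurrence, and the value 1 at
index 1 makes the vector non-zero. -/
theorem isEigenvector_of_jacobiSolution (ha : ∀ n, 0 < a n)
    (u : lp (fun _ : ℕ+ => ℝ) 2) (hu : ∀ n : ℕ+, u n = jacobiSolution a b q x n) :
    IsEigenvector (jacobiMatrix a b + Matrix.diagonal fun n : ℕ+ => q n) x u := by
  constructor
  · intro h
    have h1 := hu 1
    rw [h] at h1
    simp [jacobiSolution] at h1
  intro n
  have e : (fun m => (jacobiMatrix a b + Matrix.diagonal fun n : ℕ+ => q n) n m * u m) =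
      fun m => (if m = n then (b n + q n) * u n else 0) +
        (if m = n + 1 then a n * u (n + 1) else 0) + if n = m + 1 then a m * u m else 0 := by
    funext m
    simp only [jacobiMatrix, Matrix.add_apply, Matrix.diagonal_apply]
    by_cases h1 : n = m
    · subst h1
      have : n ≠ n + 1 := fun h => absurd (congrArg PNat.val h) (by simp)
      simp [this]
    · by_cases h2 : m = n + 1
      · subst h2
        have : n ≠ n + 1 + 1 := fun h => absurd (congrArg PNat.val h)
          (by simp only [PNat.add_coe, PNat.val_ofNat]; omega)
        simp [this, h1, Ne.symm h1]
      · simp [h1, h2, Ne.symm h1]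
  have s1 := hasSum_ite_eq n ((b n + q n) * u n)
  have s2 := hasSum_ite_eq (n + 1) (a n * u (n + 1))
  rw [e]
  induction n using PNat.recOn with
  | one =>
    have s3 : HasSum (fun m : ℕ+ => if 1 = m + 1 then a m * u m else 0) 0 := by
      convert hasSum_zero using 2 with m
      exact if_neg fun h => absurd (congrArg PNat.val h) (by simp)
    convert (s1.add s2).add s3 using 1
    rw [hu, hu, PNat.add_coe, PNat.val_ofNat, jacobiSolution_add_two 0]
    have := (ha 1).ne'
    simp only [jacobiSolution, zero_add]
    field_simp
    ring
  | succ n _ =>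
    have s3 : HasSum (fun m : ℕ+ => if n + 1 = m + 1 then a m * u m else 0) (a n * u n) := by
      convert hasSum_ite_eq n (a n * u n) using 2 with m
      by_cases h : m = n
      · simp [h]
      · have : ¬ n = m := fun h' => h h'.symm
        simp [h, this]
    convert (s1.add s2).add s3 using 1
    rw [hu, hu, hu]
    simp only [PNat.add_coe, PNat.val_ofNat]
    rw [jacobiSolution_add_two (n : ℕ)]
    have := (ha (n + 1)).ne'
    field_simp
    ring

/-- In the first step of the period, q = a₀c merges with the term a₀u_{kT}, replacing u_{kT} by
u_{kT} + c u_{kT+1}. The remaining steps are unperturbed. -/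
theorem jacobiSolution_period {T : ℕ} (ha : ∀ n, 0 < a n) (haT : Function.Periodic a T)
    (hbT : Function.Periodic b T) {k : ℕ} {c : ℝ} (hq1 : q (k * T + 1) = a 0 * c)
    (hq0 : ∀ r, 1 ≤ r → r < T → q (k * T + r + 1) = 0) {r : ℕ} (h1 : 1 ≤ r) (hr : r ≤ T) :
    ![jacobiSolution a b q x (k * T + r), jacobiSolution a b q x (k * T + r + 1)] =
      (monodromyMatrix a b x r).mulVec
        ![jacobiSolution a b q x (k * T) + c * jacobiSolution a b q x (k * T + 1),
          jacobiSolution a b q x (k * T + 1)] := by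
  have pa : ∀ r, a (k * T + r) = a r := fun r => by
    rw [add_comm]
    exact haT.nat_mul k r
  have pb : ∀ r, b (k * T + r) = b r := fun r => by
    rw [add_comm]
    exact hbT.nat_mul k r
  induction r, h1 using Nat.le_induction with
  | base =>
    have h0 := pa 0
    rw [add_zero] at h0
    rw [jacobiSolution_add_two, hq1, pa, pb, h0]
    have := (ha 1).ne'
    simp only [monodromyMatrix, transferMatrix, mul_one, zero_add, Nat.sub_self]
    ext i
    fin_cases i
    · simp [Matrix.mulVec, dotProduct, Fin.sum_univ_two]
    · simp [Matrix.mulVec, dotProduct, Fin.sum_univ_two]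
      field_simp
      ring
  | succ r h1 ih =>
    rw [monodromyMatrix, ← Matrix.mulVec_mulVec, ← ih (by omega)]
    have h2 := hq0 r h1 (by omega)
    have h3 := jacobiSolution_add_two (a := a) (b := b) (q := q) (x := x) (k * T + r)
    have pa1 := pa (r + 1)
    have pb1 := pb (r + 1)
    have := (ha (r + 1)).ne'
    rw [← add_assoc] at pa1 pb1
    rw [h2, pa, pa1, pb1] at h3
    rw [← add_assoc, add_assoc _ 1 1, h3]
    ext i
    fin_cases i
    · simp [transferMatrix, Matrix.mulVec, dotProduct, Fin.sum_univ_two]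
    · simp [transferMatrix, Matrix.mulVec, dotProduct, Fin.sum_univ_two]
      field_simp
      ring

theorem sq_add_sq_jacobiSolution_le {B : ℝ}
    (h1 : ∀ n, |(x - b (n + 1) - q (n + 1)) / a (n + 1)| ≤ B) (h2 : ∀ n, |a n / a (n + 1)| ≤ B)
    (n r : ℕ) : jacobiSolution a b q x (n + r) ^ 2 + jacobiSolution a b q x (n + r + 1) ^ 2 ≤
      (1 + 2 * B ^ 2) ^ r *
        (jacobiSolution a b q x n ^ 2 + jacobiSolution a b q x (n + 1) ^ 2) := by
  induction r with
  | zero => simp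
  | succ r ih =>
    set m := n + r
    have e : jacobiSolution a b q x (m + 2) =
        (x - b (m + 1) - q (m + 1)) / a (m + 1) * jacobiSolution a b q x (m + 1) -
          a m / a (m + 1) * jacobiSolution a b q x m := by
      rw [jacobiSolution_add_two]
      ring
    have b1 := sq_le_sq' (abs_le.1 (h1 m)).1 (abs_le.1 (h1 m)).2
    have b2 := sq_le_sq' (abs_le.1 (h2 m)).1 (abs_le.1 (h2 m)).2
    set β := (x - b (m + 1) - q (m + 1)) / a (m + 1)
    set γ := a m / a (m + 1)
    set y := jacobiSolution a b q x m
    set w := jacobiSolution a b q x (m + 1)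
    have b3 := mul_le_mul_of_nonneg_right b1 (sq_nonneg w)
    have b4 := mul_le_mul_of_nonneg_right b2 (sq_nonneg y)
    have b5 : w ^ 2 + (β * w - γ * y) ^ 2 ≤ (1 + 2 * B ^ 2) * (y ^ 2 + w ^ 2) := by
      nlinarith [sq_nonneg (β * w + γ * y), sq_nonneg y]
    change w ^ 2 + jacobiSolution a b q x (m + 2) ^ 2 ≤ _
    rw [e, pow_succ' (1 + 2 * B ^ 2), mul_assoc]
    exact b5.trans (mul_le_mul_of_nonneg_left ih (by positivity))

theorem exists_bound_of_periodic {f : ℕ → ℝ} {T : ℕ} (hT : 0 < T) (hf : Function.Periodic f T) :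
    ∃ B, ∀ n, |f n| ≤ B := by
  refine ⟨∑ i ∈ Finset.range T, |f i|, fun n => ?_⟩
  rw [← hf.map_mod_nat n]
  exact Finset.single_le_sum (f := fun i => |f i|) (fun i _ => abs_nonneg _)
    (Finset.mem_range.2 (Nat.mod_lt n hT))

/-- The recurrence has bounded coefficients, so growth within one period is bounded and sampling
once per period suffices. -/
theorem summable_sq_jacobiSolution {T : ℕ} (hT : 0 < T)
    (haT : Function.Periodic a T) (hbT : Function.Periodic b T) {R : ℝ} (hq : ∀ n, |q n| ≤ R)
    (h : Summable fun k => jacobiSolution a b q x (k * T) ^ 2 +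
      jacobiSolution a b q x (k * T + 1) ^ 2) :
    Summable fun n => jacobiSolution a b q x n ^ 2 := by
  have p1 : Function.Periodic (fun n => a n / a (n + 1)) T := fun n => by
    simp only [add_right_comm n T 1, haT n, haT (n + 1)]
  have p2 : Function.Periodic (fun n => (x - b (n + 1)) / a (n + 1)) T := fun n => by
    simp only [add_right_comm n T 1, haT (n + 1), hbT (n + 1)]
  have p3 : Function.Periodic (fun n => 1 / a (n + 1)) T := fun n => by
    simp only [add_right_comm n T 1, haT (n + 1)]
  obtain ⟨B1, hB1⟩ := exists_bound_of_periodic hT p1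
  obtain ⟨B2, hB2⟩ := exists_bound_of_periodic hT p2
  obtain ⟨B3, hB3⟩ := exists_bound_of_periodic hT p3
  have n1 := (abs_nonneg _).trans (hB1 0)
  have n2 := (abs_nonneg _).trans (hB2 0)
  have n3 := (abs_nonneg _).trans (hB3 0)
  have nR := (abs_nonneg _).trans (hq 0)
  have key := sq_add_sq_jacobiSolution_le (a := a) (b := b) (q := q) (x := x)
    (B := B1 + (B2 + R * B3)) (fun n => by
      have e : (x - b (n + 1) - q (n + 1)) / a (n + 1) =
          (x - b (n + 1)) / a (n + 1) - q (n + 1) * (1 / a (n + 1)) := by ring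
      rw [e]
      refine (abs_sub _ _).trans ?_
      rw [abs_mul]
      have := mul_le_mul (hq (n + 1)) (hB3 n) (abs_nonneg _) nR
      linarith [hB2 n])
    (fun n => by
      have := mul_nonneg nR n3
      linarith [hB1 n])
  set D := 1 + 2 * (B1 + (B2 + R * B3)) ^ 2
  have hD : 1 ≤ D := by
    have := sq_nonneg (B1 + (B2 + R * B3))
    simp only [D]
    linarith
  have : NeZero T := ⟨hT.ne'⟩
  rw [← (Nat.divModEquiv T).symm.summable_iff]
  have hprod : Summable fun p : ℕ × Fin T => D ^ T * (jacobiSolution a b q x (p.1 * T) ^ 2 +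
      jacobiSolution a b q x (p.1 * T + 1) ^ 2) := by
    have := (h.mul_left (D ^ T)).mul_of_nonneg (g := fun _ : Fin T => (1 : ℝ))
      (Summable.of_finite) (fun k => by positivity) (fun _ => zero_le_one)
    simpa using this
  refine Summable.of_nonneg_of_le (fun p => sq_nonneg _) (fun p => ?_) hprod
  have e : (Nat.divModEquiv T).symm p = p.1 * T + (p.2 : ℕ) := rfl
  have k1 := key (p.1 * T) p.2
  have k2 : D ^ (p.2 : ℕ) ≤ D ^ T := pow_le_pow_right₀ hD p.2.2.le
  have k3 := mul_le_mul_of_nonneg_right k2 (by positivity :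
    0 ≤ jacobiSolution a b q x (p.1 * T) ^ 2 + jacobiSolution a b q x (p.1 * T + 1) ^ 2)
  simp only [Function.comp, e]
  linarith [sq_nonneg (jacobiSolution a b q x (p.1 * T + (p.2 : ℕ) + 1))]

end Solution

/-- If the perturbed monodromy acts on each period as a shear followed by a rotation whose iterates
are square summable, then the solution of the Jacobi recurrence is square summable. -/
theorem summable_sq_of_shears {a b q : ℕ → ℝ} {x : ℝ} {T : ℕ} (hT : 0 < T) (ha : ∀ n, 0 < a n)
    (haT : Function.Periodic a T) (hbT : Function.Periodic b T) {R : ℝ} (hq : ∀ n, |q n| ≤ R)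
    {c : ℕ → ℝ} (hq1 : ∀ k, q (k * T + 1) = a 0 * c k)
    (hq0 : ∀ k r, 1 ≤ r → r < T → q (k * T + r + 1) = 0) {l ρ : ℂ} (hl : l.im ≠ 0)
    (hM : ∀ v : Fin 2 → ℝ, (((monodromyMatrix a b x T).mulVec v 0 : ℝ) : ℂ) +
      l * ((monodromyMatrix a b x T).mulVec v 1 : ℝ) = ρ * (v 0 + l * v 1))
    {z : ℕ → ℂ} (hz0 : z 0 = l) (hz : ∀ k, z (k + 1) = ρ * shear (c k * l.im⁻¹) (z k))
    (hs : Summable fun k => Complex.normSq (z k)) :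
    Summable fun n => jacobiSolution a b q x n ^ 2 := by
  have hcoord : ∀ k, z k =
      jacobiSolution a b q x (k * T) + l * jacobiSolution a b q x (k * T + 1) := by
    intro k
    induction k with
    | zero => simp [hz0, jacobiSolution]
    | succ k ih =>
      have h := jacobiSolution_period (x := x) ha haT hbT (hq1 k) (hq0 k) hT le_rfl
      have hv := hM ![jacobiSolution a b q x (k * T) + c k * jacobiSolution a b q x (k * T + 1),
          jacobiSolution a b q x (k * T + 1)]
      rw [← h] at hv
      simp only [Matrix.cons_val_zero, Matrix.cons_val_one] at hv
      have him : (z k).im = l.im * jacobiSolution a b q x (k * T + 1) := by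
        rw [ih]
        simp
      have hsh : c k * l.im⁻¹ * (z k).im = c k * jacobiSolution a b q x (k * T + 1) := by
        rw [him]
        field_simp
      rw [add_mul, one_mul, hv, hz, shear, hsh, ih]
      push_cast
      ring
  refine summable_sq_jacobiSolution hT haT hbT hq ?_
  -- Since Im l ≠ 0, both real components are recovered linearly from z, which gives the constant.
  refine Summable.of_nonneg_of_le (fun k => by positivity) (fun k => ?_)
    (hs.mul_left (2 + (1 + 2 * l.re ^ 2) * (l.im⁻¹) ^ 2))
  have him : (z k).im = l.im * jacobiSolution a b q x (k * T + 1) := by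
    rw [hcoord]
    simp
  have hre : (z k).re =
      jacobiSolution a b q x (k * T) + l.re * jacobiSolution a b q x (k * T + 1) := by
    rw [hcoord]
    simp
  have hw : jacobiSolution a b q x (k * T + 1) = l.im⁻¹ * (z k).im := by
    rw [him, inv_mul_cancel_left₀ hl]
  have hy : jacobiSolution a b q x (k * T) = (z k).re - l.re * (l.im⁻¹ * (z k).im) := by
    rw [hre, ← hw]
    ring
  rw [hy, hw, Complex.normSq_apply]
  generalize l.im⁻¹ = m
  nlinarith [sq_nonneg ((z k).re + l.re * (m * (z k).im)), sq_nonneg ((z k).im),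
    sq_nonneg ((z k).re * m), sq_nonneg (l.re * m * (z k).re)]

/-! ### The amplitude, the potential and the conclusion -/

theorem exists_slow_amplitude {f : ℕ → ℝ} (hf0 : ∀ k, 0 < f k) (hf : Tendsto f atTop atTop) :
    ∃ μ : ℕ → ℝ, (∀ k, 0 ≤ μ k) ∧ (∀ k, μ k ≤ 1) ∧ (∀ k, μ k ≤ f k / ((k : ℝ) + 1)) ∧
      Tendsto μ atTop (𝓝 0) ∧ (Summable fun k => μ k ^ 2) ∧
      Tendsto (fun k : ℕ => ((k : ℝ) + 1) * μ k) atTop atTop := by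
  have hn : Tendsto (fun k : ℕ => (k : ℝ) + 1) atTop atTop :=
    tendsto_atTop_add_const_right _ _ tendsto_natCast_atTop_atTop
  have h34 : ∀ k : ℕ, ((k : ℝ) + 1) ^ (1 / 4 : ℝ) / ((k : ℝ) + 1) =
      ((k : ℝ) + 1) ^ (-(3 / 4) : ℝ) := fun k => by
    rw [← Real.rpow_sub_one (by positivity)]
    norm_num
  -- The cap (k+1)^{1/4} still tends to infinity, while its quotient by k+1 is square summable.
  set μ : ℕ → ℝ := fun k => min (f k) (((k : ℝ) + 1) ^ (1 / 4 : ℝ)) / ((k : ℝ) + 1)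
  have h0 : ∀ k, 0 ≤ μ k := fun k =>
    div_nonneg (le_min (hf0 k).le (by positivity)) (by positivity)
  have hle : ∀ k, μ k ≤ ((k : ℝ) + 1) ^ (-(3 / 4) : ℝ) := fun k => by
    rw [← h34]
    exact div_le_div_of_nonneg_right (min_le_right _ _) (by positivity)
  refine ⟨μ, h0, fun k => (hle k).trans ?_,
    fun k => div_le_div_of_nonneg_right (min_le_left _ _) (by positivity), ?_, ?_, ?_⟩
  · exact Real.rpow_le_one_of_one_le_of_nonpos (by linarith [Nat.cast_nonneg (α := ℝ) k])
      (by norm_num)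
  · exact squeeze_zero h0 hle ((tendsto_rpow_neg_atTop (by norm_num)).comp hn)
  · have h1 : Summable fun k : ℕ => ((k : ℝ) + 1) ^ (-(3 / 2) : ℝ) := by
      have := (summable_nat_add_iff 1).2
        (Real.summable_nat_rpow.2 (by norm_num : (-(3 / 2) : ℝ) < -1))
      simpa using this
    refine Summable.of_nonneg_of_le (fun k => sq_nonneg _) (fun k => ?_) h1
    refine (pow_le_pow_left₀ (h0 k) (hle k) 2).trans_eq ?_
    rw [← Real.rpow_natCast, ← Real.rpow_mul (by positivity)]
    norm_num
  · have e : (fun k : ℕ => ((k : ℝ) + 1) * μ k) =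
        fun k : ℕ => min (f k) (((k : ℝ) + 1) ^ (1 / 4 : ℝ)) := by
      funext k
      exact mul_div_cancel₀ _ (by positivity)
    rw [e]
    have h2 := (tendsto_rpow_atTop (by norm_num : (0 : ℝ) < 1 / 4)).comp hn
    rw [tendsto_atTop] at hf h2 ⊢
    intro A
    filter_upwards [hf A, h2 A] with k hk1 hk2
    exact le_min hk1 hk2

open Classical in
/-- The potential with the value `d k` at the site `k T + 1` and `0` at all other sites. -/
noncomputable def sparsePotential (T : ℕ) (d : ℕ → ℝ) (n : ℕ) : ℝ :=
  if n ≡ 1 [MOD T] then d ((n - 1) / T) else 0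

theorem sparsePotential_mul_add_one {T : ℕ} (hT : 0 < T) (d : ℕ → ℝ) (k : ℕ) :
    sparsePotential T d (k * T + 1) = d k := by
  have h : k * T + 1 ≡ 1 [MOD T] := by simp [Nat.ModEq]
  rw [sparsePotential, if_pos h, Nat.add_sub_cancel, Nat.mul_div_cancel _ hT]

theorem sparsePotential_eq_zero {T : ℕ} (d : ℕ → ℝ) (k : ℕ) {r : ℕ} (h1 : 1 ≤ r) (hr : r < T) :
    sparsePotential T d (k * T + r + 1) = 0 := by
  refine if_neg fun h => ?_
  have h2 : r ≡ 0 [MOD T] := by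
    have h3 : k * T + r ≡ 0 [MOD T] := Nat.ModEq.add_right_cancel' 1 (by simpa using h)
    simpa [Nat.ModEq] using h3
  rw [Nat.ModEq, Nat.mod_eq_of_lt hr, Nat.zero_mod] at h2
  omega

theorem theorem4p1 (T : ℕ) (hT : 0 < T) (a b : ℕ → ℝ) (ha : ∀ n, 0 < a n)
    (haT : Function.Periodic a T) (hbT : Function.Periodic b T)
    (lam : ℕ+ → ℝ) (hlam : ∀ i, lam i ∈ ellipticPoints a b T)
    (hind : ∀ n : ℕ, LinearIndependent ℚ
      (Fin.cons π (fun j : Fin n => quasiMomentum a b T (lam (Nat.succPNat ((j : ℕ) + 1)))) :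
        Fin (n + 1) → ℝ))
    (p q : ℕ) (hq : 0 < q) (hpq : Nat.Coprime p q)
    (hlam1 : quasiMomentum a b T (lam 1) = p * π / q)
    (hlam1' : quasiMomentum a b T (lam 1) ≠ π / 2)
    (K : ℕ+ → ℝ) (hKpos : ∀ n, 0 < K n) (hK : Tendsto K atTop atTop) :
    ∃ Q : ℕ+ → ℝ,
      (∀ n : ℕ+, |Q n| ≤ K n / (n : ℝ)) ∧
      Tendsto Q atTop (𝓝 0) ∧
      (∀ n : ℕ+, ¬ (n : ℕ) ≡ 1 [MOD T] → Q n = 0) ∧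
      ∃ u : ℕ+ → lp (fun _ : ℕ+ => ℝ) 2,
        ∀ i, IsEigenvector (jacobiMatrix a b + Matrix.diagonal Q) (lam i) (u i) := by
  set θ : ℕ → ℝ := fun i => quasiMomentum a b T (lam (Nat.succPNat i))
  have hθ : ∀ i, IsQuasiMomentum a b T (lam (Nat.succPNat i)) (θ i) := by
    intro i
    have h := (existsUnique_isQuasiMomentum a b T _ ha haT (hlam (Nat.succPNat i))).exists
    simp only [θ, quasiMomentum]
    rw [dif_pos h]
    exact h.choose_spec
  obtain ⟨hadd, hinj⟩ := nonresonant_of_linearIndependent (fun i => (hθ i).1) hind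
    (r := (p : ℚ) / q) (by
      push_cast
      rw [div_mul_eq_mul_div]
      exact hlam1) hlam1'
  set ρ : ℕ → ℂ := fun i => Complex.exp (Complex.I * θ i)
  have hρ : ∀ i, ‖ρ i‖ = 1 := fun i => by
    simp only [ρ]
    rw [mul_comm, Complex.norm_exp_ofReal_mul_I]
  have hρim : ∀ i, (ρ i).im ≠ 0 := fun i => by
    simp only [ρ]
    rw [mul_comm, Complex.exp_ofReal_mul_I_im]
    exact (Real.sin_pos_of_mem_Ioo (hθ i).1).ne'
  have hcoord := fun i => exists_complex_coordinate (monodromyMatrix a b (lam (Nat.succPNat i)) T)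
    (by rw [det_monodromyMatrix a b _ ha, haT.eq, div_self (ha 0).ne'])
    ((mem_spectrum_monodromyMatrix a b T _ ha haT (ρ i)).1 (by rw [(hθ i).2]; exact Or.inl rfl))
    (hρim i)
  choose l hl hM using hcoord
  -- At n = kT+1 the bound a₀μ_k becomes K(n) / (T(k+1)), and T(k+1) ≥ n.
  set f : ℕ → ℝ := fun k => K (Nat.succPNat (k * T)) / (a 0 * T)
  have hTpos : (0 : ℝ) < T := by exact_mod_cast hT
  have hf : Tendsto f atTop atTop := by
    refine Tendsto.atTop_div_const (mul_pos (ha 0) hTpos) (hK.comp ?_)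
    refine tendsto_atTop_atTop_of_monotone (fun k m hkm => ?_) fun n => ⟨n, ?_⟩
    · exact Nat.succPNat_le_succPNat.2 (Nat.mul_le_mul_right T hkm)
    · rw [← PNat.coe_le_coe, Nat.succPNat_coe]
      exact (Nat.le_mul_of_pos_right _ hT).trans (Nat.le_succ _)
  obtain ⟨μ, hμ0, hμ1, hμf, hμlim, hμ2, hμ3⟩ :=
    exists_slow_amplitude (fun k => div_pos (hKpos _) (mul_pos (ha 0) hTpos)) hf
  -- The starting point l i is the coordinate of the initial vector (u₀, u₁) = (0, 1).
  obtain ⟨c, hc, z, hz0, hz, hzs⟩ := exists_shears_summable_normSq (α := fun i => (l i).im⁻¹)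
    (x := ρ) (z₀ := l) (fun i => inv_ne_zero (hl i)) hρ
    (fun i j h => hadd i j (add_eq_pi_of_exp_sq_mul_exp_sq (hθ i).1 (hθ j).1 h))
    (fun i j hij h => hij (hinj (eq_of_exp_sq_eq_exp_sq (hθ i).1 (hθ j).1 h)))
    (fun i h => hl i (by rw [h, Complex.zero_im])) hμ0 hμ2 hμ3
  set w := sparsePotential T fun k => a 0 * c k
  have hw1 : ∀ k, w (k * T + 1) = a 0 * c k := sparsePotential_mul_add_one hT _
  have hwμ : ∀ n, |w n| ≤ a 0 * μ ((n - 1) / T) := by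
    intro n
    simp only [w, sparsePotential]
    split_ifs
    · rw [abs_mul, abs_of_pos (ha 0)]
      exact mul_le_mul_of_nonneg_left (hc _) (ha 0).le
    · rw [abs_zero]
      exact mul_nonneg (ha 0).le (hμ0 _)
  have hwb : ∀ n, |w n| ≤ a 0 := fun n =>
    (hwμ n).trans (mul_le_of_le_one_right (ha 0).le (hμ1 _))
  have hsum : ∀ i, Summable fun n => jacobiSolution a b w (lam (Nat.succPNat i)) n ^ 2 :=
    fun i => summable_sq_of_shears hT ha haT hbT hwb hw1
      (fun k r h1 h2 => sparsePotential_eq_zero _ k h1 h2) (hl i) (hM i) (hz0 i)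
      (fun k => hz k i) (hzs i)
  refine ⟨fun n => w n, fun n => ?_, ?_, fun n hn => if_neg hn, ?_⟩
  · by_cases hn : (n : ℕ) ≡ 1 [MOD T]
    · obtain ⟨k, hk⟩ := (Nat.modEq_iff_dvd' n.pos).1 hn.symm
      have hnk : (n : ℕ) = k * T + 1 := by
        have := n.pos
        rw [mul_comm k, ← hk]
        omega
      have hns : n = Nat.succPNat (k * T) := PNat.eq (by rw [hnk, Nat.succPNat_coe])
      have hKn : 0 < K n := hKpos n
      change |w n| ≤ K n / ((n : ℕ) : ℝ)
      rw [hnk, hw1, abs_mul, abs_of_pos (ha 0)]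
      calc a 0 * |c k| ≤ a 0 * (f k / ((k : ℝ) + 1)) :=
            mul_le_mul_of_nonneg_left ((hc k).trans (hμf k)) (ha 0).le
        _ = K n / ((T : ℝ) * ((k : ℝ) + 1)) := by
            simp only [f]
            rw [← hns]
            have := (ha 0).ne'
            field_simp
        _ ≤ K n / ((k * T + 1 : ℕ) : ℝ) := by
            refine div_le_div_of_nonneg_left hKn.le (by positivity) ?_
            have : (1 : ℝ) ≤ T := by exact_mod_cast hT
            push_cast
            linarith
    · change |w n| ≤ K n / ((n : ℕ) : ℝ)
      rw [show w n = 0 from if_neg hn, abs_zero]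
      exact div_nonneg (hKpos n).le (by positivity)
  · have h1 : Tendsto (fun n : ℕ => a 0 * μ ((n - 1) / T)) atTop (𝓝 0) := by
      rw [← mul_zero (a 0)]
      exact ((hμlim.comp (Nat.tendsto_div_const_atTop hT.ne')).comp
        (tendsto_sub_atTop_nat 1)).const_mul _
    exact (squeeze_zero_norm (fun n => (Real.norm_eq_abs (w n)).trans_le (hwμ n)) h1).comp tendsto_PNat_val_atTop_atTop
  · have hmem : ∀ i, Memℓp (fun n : ℕ+ => jacobiSolution a b w (lam i) n) 2 := by
      intro i
      have h := (hsum i.natPred).comp_injective PNat.coe_injective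
      rw [PNat.succPNat_natPred] at h
      exact memℓp_gen (by simpa [Function.comp_def] using h)
    exact ⟨fun i => ⟨_, hmem i⟩, fun i => isEigenvector_of_jacobiSolution ha _ fun _ => rfl⟩
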